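/- Let $X=\mathbb{R}/\mathbb{Z}$ with its quotient distance and normalized Lebesgue measure $\ell$, let $T(x)=2x$ on $X$, and let $\tau_i(x)=\frac{x}{2}+\frac{i}{2}$, $i\in\mathcal{I}=\{0,1\}$, be the inverse branches of $T$ (with $x$ represented in $[0,1)$). Let $m\ge 1$, $\mathcal{C}=\{0,\dots,m-1\}$, and let $A_c:X\to\mathbb{R}$, $c\in\mathcal{C}$, be Lipschitz functions. For $0<\lambda<1$, $x\in X$, $\bar c=(c_0,c_1,\dots)\in\mathcal{C}^{\mathbb{N}}$ and $\bar a=(a_0,a_1,\dots)\in\mathcal{I}^{\mathbb{N}}$ put $$S_x(\bar c,\bar a)=\sum_{i=0}^{\infty}\lambda^i A_{c_i}\bigl(\tau_{a_i}\circ\cdots\circ\tau_{a_0}(x)\bigr),\qquad v_\lambda^{+}(x)=\sup_{\bar c,\bar a}S_x(\bar c,\bar a),\qquad v_\lambda^{-}(x)=\inf_{\bar c,\bar a}S_x(\bar c,\bar a).$$ Let $\nu$ and $\eta$ be the uniform Bernoulli measures on $\mathcal{C}^{\mathbb{N}}$ and $\mathcal{I}^{\mathbb{N}}$, and let the random SRB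 measure $\mu=\mu_\lambda$ on $X\times\mathbb{R}\times\mathcal{C}^{\mathbb{N}}$ be the image of $\ell\times\eta\times\nu\times\nu$ under $\Psi(x,\bar a,\bar c,\bar b)=(x,S_x(\bar c,\bar a),\bar b)$. Write $\bar b=(b_{-1},b_{-2},\dots)$ for the elements of the last factor $\mathcal{C}^{\mathbb{N}}$, and $\Pi_{\{1,3\}}(x,y,\bar b)=(x,\bar b)$. Let $\mathcal{H}$ be the set of holonomic probabilities, that is, of the Borel probability measures $\rho$ on $X\times\mathcal{C}\times\mathcal{I}$ with $\int \bigl(g(\tau_a x)-g(x)\bigr)\,d\rho(x,c,a)=0$ for every continuous $g:X\to\mathbb{R}$, and let $\bar u=\sup_{\rho\in\mathcal{H}}\int A_c(\tau_a x)\,d\rho(x,c,a)$. Then: (a) For every $0<\lambda<1$, the functions $v_\lambda^{\pm}$ are $\ell$-integrable and $$\int_X v_\lambda^-\,d\ell\le\int_{X\times\mathbb{R}\times\mathcal{C}^{\mathbb{N}}} y\,d\mu(x,y,\bar b)\le\int_X v_\lambda^+\,d\ell .$$ (b) For every $0<\lambda<1$, the function $(x,y,\bar b)\mapsto y$ belongs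 to $L^1(\mu)$. (c) For every $0<\lambda<1$ there is a measurable set $\Omega\subseteq X\times\mathbb{R}\times\mathcal{C}^{\mathbb{N}}$ with $\mu(\Omega)=1$ such that, for all $(x,\bar b)\in\Pi_{\{1,3\}}\Omega$, $$\frac1N\sum_{j=1}^{N-1}A_{b_{-j}}(T^{j-1}(x))\longrightarrow(1-\lambda)\int y\,d\mu(x,y,\bar b)\qquad(N\to\infty).$$ (d) For every $\varepsilon>0$ there is $\lambda_0\in(0,1)$ such that for every $\lambda\in(\lambda_0,1)$ there is a measurable set $\Omega_\lambda\subseteq X\times\mathbb{R}\times\mathcal{C}^{\mathbb{N}}$ with $\mu_\lambda(\Omega_\lambda)=1$ such that, for all $(x,\bar b)\in\Pi_{\{1,3\}}\Omega_\lambda$, there is $N_0$ with $$\frac1N\sum_{j=1}^{N-1}A_{b_{-j}}(T^{j-1}(x))\le\bar u+\varepsilon\qquad\text{for all }N\ge N_0.$$ -/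

import Mathlib

open MeasureTheory Filter
open scoped Topology NNReal ENNReal

noncomputable section

namespace SkewIFS

/-- The circle `ℝ/ℤ`, with its quotient distance and normalized Lebesgue measure `volume`. -/
abbrev X : Type := UnitAddCircle

instance isProbabilityMeasure_volume : IsProbabilityMeasure (volume : Measure X) :=
  ⟨UnitAddCircle.measure_univ⟩

/-- The doubling map `T x = 2x` on the circle. -/
def T (x : X) : X := 2 • x

/-- The inverse branches `τ_i x = x/2 + i/2` of `T`, where `x` is represented in `[0, 1)`. -/
def tau (i : Fin 2) (x : X) : X :=
  (((AddCircle.equivIco (1 : ℝ) 0 x : ℝ) / 2 + (i : ℝ) / 2 : ℝ) : X)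

/-- `branch a n x = τ_{a_{n-1}} (⋯ (τ_{a_0} x))`. -/
def branch (a : ℕ → Fin 2) : ℕ → X → X
  | 0, x => x
  | n + 1, x => tau (a n) (branch a n x)

variable {m : ℕ}

/-- `S_x(c, a) = ∑_{i ≥ 0} λ^i A_{c_i} (τ_{a_i} ∘ ⋯ ∘ τ_{a_0} (x))`. -/
def S (A : Fin m → X → ℝ) (lam : ℝ) (x : X) (c : ℕ → Fin m) (a : ℕ → Fin 2) : ℝ :=
  ∑' i : ℕ, lam ^ i * A (c i) (branch a (i + 1) x)

/-- The upper boundary function `v_λ⁺(x)`: the largest value of `S_x`. -/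
def vPlus (A : Fin m → X → ℝ) (lam : ℝ) (x : X) : ℝ :=
  ⨆ ca : (ℕ → Fin m) × (ℕ → Fin 2), S A lam x ca.1 ca.2

/-- The lower boundary function `v_λ⁻(x)`: the smallest value of `S_x`. -/
def vMinus (A : Fin m → X → ℝ) (lam : ℝ) (x : X) : ℝ :=
  ⨅ ca : (ℕ → Fin m) × (ℕ → Fin 2), S A lam x ca.1 ca.2

/-- The uniform Bernoulli measure on `{0, …, k-1}^ℕ`. -/
def bernoulli (k : ℕ) [NeZero k] : Measure (ℕ → Fin k) :=
  Measure.infinitePi fun _ : ℕ => (PMF.uniformOfFintype (Fin k)).toMeasure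

instance isProbabilityMeasure_bernoulli (k : ℕ) [NeZero k] :
    IsProbabilityMeasure (bernoulli k) := by
  unfold bernoulli; infer_instance

/-- `Ψ(x, a, c, b) = (x, S_x(c, a), b)`. -/
def Psi (A : Fin m → X → ℝ) (lam : ℝ) :
    X × (ℕ → Fin 2) × (ℕ → Fin m) × (ℕ → Fin m) → X × ℝ × (ℕ → Fin m) :=
  fun p => (p.1, S A lam p.1 p.2.2.1 p.2.1, p.2.2.2)

/-- The random SRB measure `μ = Ψ_*(ℓ × η × ν × ν)`. -/
def srb [NeZero m] (A : Fin m → X → ℝ) (lam : ℝ) : Measure (X × ℝ × (ℕ → Fin m)) :=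
  Measure.map (Psi A lam)
    ((volume : Measure X).prod ((bernoulli 2).prod ((bernoulli m).prod (bernoulli m))))

/-- The holonomic probabilities on `X × 𝒞 × ℐ`. -/
def holonomic (m : ℕ) : Set (Measure (X × Fin m × Fin 2)) :=
  {ρ | IsProbabilityMeasure ρ ∧ ∀ g : C(X, ℝ), ∫ p, (g (tau p.2.2 p.1) - g p.1) ∂ρ = 0}

/-- `ū`, the supremum of `∫ A_c(τ_a x) dρ` over the holonomic probabilities `ρ`. -/
def uBar (A : Fin m → X → ℝ) : ℝ :=
  sSup ((fun ρ : Measure (X × Fin m × Fin 2) => ∫ p, A p.2.1 (tau p.2.2 p.1) ∂ρ) '' holonomic m)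

/-- `(1/N) ∑_{j=1}^{N-1} A_{b_{-j}} (T^{j-1} x)`, where `b k` stands for the entry
`b_{-(k+1)}` of the sequence `(b_{-1}, b_{-2}, …)`. -/
def orbitAverage (A : Fin m → X → ℝ) (x : X) (b : ℕ → Fin m) (N : ℕ) : ℝ :=
  (1 / (N : ℝ)) * ∑ j ∈ Finset.Ico 1 N, A (b (j - 1)) (T^[j - 1] x)

theorem measurable_tau (i : Fin 2) : Measurable (tau i) := by
  unfold tau
  have h : Measurable fun x : X => ((AddCircle.equivIco (1 : ℝ) 0 x : ℝ)) :=
    (AddCircle.measurableEquivIco (1 : ℝ) 0).measurable.subtype_val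
  exact AddCircle.measurable_mk'.comp ((h.div_const 2).add_const _)

theorem measurable_branch (n : ℕ) :
    Measurable fun p : (ℕ → Fin 2) × X => branch p.1 n p.2 := by
  induction n with
  | zero => exact measurable_snd
  | succ n ih =>
    have h : Measurable fun q : Fin 2 × X => tau q.1 q.2 :=
      measurable_from_prod_countable_right measurable_tau
    exact h.comp (((measurable_pi_apply n).comp measurable_fst).prodMk ih)

theorem measurable_Psi {A : Fin m → X → ℝ} (hA : ∀ c, Measurable (A c)) (lam : ℝ) :
    Measurable (Psi A lam) := by
  have hA' : Measurable fun q : Fin m × X => A q.1 q.2 :=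
    measurable_from_prod_countable_right hA
  have h : ∀ i : ℕ, Measurable fun p : X × (ℕ → Fin 2) × (ℕ → Fin m) × (ℕ → Fin m) =>
      A (p.2.2.1 i) (branch p.2.1 (i + 1) p.1) := fun i => by
    have h1 : Measurable fun p : X × (ℕ → Fin 2) × (ℕ → Fin m) × (ℕ → Fin m) => p.2.2.1 i :=
      (measurable_pi_apply i).comp measurable_snd.snd.fst
    have h2 : Measurable fun p : X × (ℕ → Fin 2) × (ℕ → Fin m) × (ℕ → Fin m) =>
        branch p.2.1 (i + 1) p.1 :=
      (measurable_branch (i + 1)).comp (measurable_snd.fst.prodMk measurable_fst)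
    exact hA'.comp (h1.prodMk h2)
  refine measurable_fst.prodMk (Measurable.prodMk ?_ measurable_snd.snd.snd)
  exact Measurable.tsum fun i => (h i).const_mul (lam ^ i)

theorem isProbabilityMeasure_srb [NeZero m] {A : Fin m → X → ℝ} (hA : ∀ c, Measurable (A c))
    (lam : ℝ) : IsProbabilityMeasure (srb A lam) :=
  Measure.isProbabilityMeasure_map (measurable_Psi hA lam).aemeasurable

end SkewIFS

end

/-!
The proof rests on one number, `meanObs A`, the mean of `A_c(x)` over a uniform symbol `c` and a
Lebesgue point `x`; every quantity of the theorem is compared with it.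

* The pair (shifted branch sequence, `τ_{a_0} x`) is distributed like (branch sequence, `x`)
  (`measurePreserving_skew`), so `τ_{a_i} ∘ ⋯ ∘ τ_{a_0} (x)` is Lebesgue distributed and each term
  of the series `S_x` has mean `λ^i * meanObs A`. Hence `(1 - λ) ∫ y dμ = meanObs A`
  (`integral_S`).
* The averages along `(T^j x, b_j)` converge almost surely to `meanObs A`
  (`ae_tendsto_orbitAverage`). No ergodic theorem is used: after centering, independence of the
  symbols reduces correlations to those of one Lipschitz function under the doubling map, which
  decay like `2^{-n}` because the inverse branches contract (`abs_integral_mul_comp_iterate_le`);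
  then a second moment argument along the squares applies (`ae_tendsto_average_zero`).
* Lebesgue measure with independent uniform symbols is a holonomic probability whose integral is
  `meanObs A`, so `meanObs A ≤ ū` (`meanObs_le_uBar`). As the limit of the averages does not depend
  on `λ`, the bound by `ū + ε` holds for every `λ`.
* The bounds on the mean of `y` are the pointwise bounds `v⁻ ≤ S ≤ v⁺` integrated. The point needing
  care is the measurability of `v⁺`, a supremum over an uncountable family of functions that are
  discontinuous on the circle: in the coordinate `[0, 1)` they are continuous, so `v⁺` is lower
  semicontinuous there (`measurable_vPlus`).
-/

noncomputable section

namespace SkewIFS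

variable {m : ℕ}

/-! ### The inverse branches in the coordinate `[0, 1)` -/

/-- The representative in `[0, 1)` of a point of the circle. -/
def rep (x : X) : ℝ := (AddCircle.equivIco (1 : ℝ) 0 x : ℝ)

theorem rep_mem (x : X) : rep x ∈ Set.Ico (0 : ℝ) 1 := by
  simpa [rep] using (AddCircle.equivIco (1 : ℝ) 0 x).2

theorem coe_rep (x : X) : ((rep x : ℝ) : X) = x := AddCircle.coe_equivIco

theorem rep_coe {t : ℝ} (ht : t ∈ Set.Ico (0 : ℝ) 1) : rep (t : X) = t :=
  AddCircle.equivIco_coe_of_mem (by simpa using ht)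

theorem tau_coe (i : Fin 2) {t : ℝ} (ht : t ∈ Set.Ico (0 : ℝ) 1) :
    tau i (t : X) = ((t / 2 + (i : ℝ) / 2 : ℝ) : X) := by
  have h := rep_coe ht
  unfold rep at h
  rw [tau, h]

/-- The composition `τ_{a_{n-1}} ∘ ⋯ ∘ τ_{a_0}` read in the coordinate `[0, 1)`: an affine map of
slope `2⁻ⁿ`. -/
def branchLift (a : ℕ → Fin 2) : ℕ → ℝ → ℝ
  | 0, t => t
  | n + 1, t => branchLift a n t / 2 + (a n : ℝ) / 2

theorem branchLift_mem (a : ℕ → Fin 2) (n : ℕ) {t : ℝ} (ht : t ∈ Set.Ico (0 : ℝ) 1) :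
    branchLift a n t ∈ Set.Ico (0 : ℝ) 1 := by
  induction n with
  | zero => exact ht
  | succ n ih =>
    have h1 : ((a n : ℕ) : ℝ) ≤ 1 := by exact_mod_cast Nat.lt_succ_iff.mp (a n).2
    have h0 : (0 : ℝ) ≤ ((a n : ℕ) : ℝ) := Nat.cast_nonneg _
    obtain ⟨h2, h3⟩ := ih
    constructor
    · simp only [branchLift]; positivity
    · simp only [branchLift]; linarith

theorem branch_coe (a : ℕ → Fin 2) (n : ℕ) {t : ℝ} (ht : t ∈ Set.Ico (0 : ℝ) 1) :
    branch a n (t : X) = (branchLift a n t : X) := by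
  induction n with
  | zero => rfl
  | succ n ih => rw [branch, ih, tau_coe _ (branchLift_mem a n ht), branchLift]

theorem continuous_branchLift (a : ℕ → Fin 2) (n : ℕ) : Continuous (branchLift a n) := by
  induction n with
  | zero => exact continuous_id
  | succ n ih => exact (ih.div_const 2).add_const _

theorem branchLift_sub (a : ℕ → Fin 2) (n : ℕ) (s t : ℝ) :
    branchLift a n s - branchLift a n t = (1 / 2) ^ n * (s - t) := by
  induction n with
  | zero => simp [branchLift]
  | succ n ih => simp only [branchLift]; rw [pow_succ]; linear_combination (1 / 2) * ih

theorem dist_branch_le (a : ℕ → Fin 2) (n : ℕ) (x y : X) :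
    dist (branch a n x) (branch a n y) ≤ (1 / 2) ^ n := by
  rw [← coe_rep x, ← coe_rep y, branch_coe a n (rep_mem x), branch_coe a n (rep_mem y),
    dist_eq_norm, ← AddCircle.coe_sub, branchLift_sub]
  have h1 : |rep x - rep y| ≤ 1 := by
    have hx := rep_mem x
    have hy := rep_mem y
    rw [abs_le]; constructor <;> linarith [hx.1, hx.2, hy.1, hy.2]
  calc ‖(((1 / 2) ^ n * (rep x - rep y) : ℝ) : X)‖ ≤ |(1 / 2) ^ n * (rep x - rep y)| :=
        QuotientAddGroup.norm_mk_le_norm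
    _ = (1 / 2) ^ n * |rep x - rep y| := by rw [abs_mul, abs_of_pos (by positivity)]
    _ ≤ (1 / 2) ^ n := mul_le_of_le_one_right (by positivity) h1

theorem T_tau (i : Fin 2) (x : X) : T (tau i x) = x := by
  rw [T, tau, ← AddCircle.coe_nsmul]
  conv_rhs => rw [← coe_rep x]
  have h : (2 : ℕ) • ((AddCircle.equivIco (1 : ℝ) 0 x : ℝ) / 2 + ((i : ℕ) : ℝ) / 2)
      = rep x + ((i : ℕ) : ℝ) * 1 := by
    rw [rep, nsmul_eq_mul]; push_cast; ring
  rw [h, AddCircle.coe_add, ← nsmul_eq_mul, AddCircle.coe_nsmul, AddCircle.coe_period]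
  simp

theorem iterate_T_branch (a : ℕ → Fin 2) (n : ℕ) (x : X) : T^[n] (branch a n x) = x := by
  induction n with
  | zero => rfl
  | succ n ih => rw [Function.iterate_succ_apply, branch, T_tau, ih]

/-- Composing in the other order: the first branch is applied first, the others after it. -/
theorem branch_succ' (a : ℕ → Fin 2) (n : ℕ) (x : X) :
    branch a (n + 1) x = branch (fun k => a (k + 1)) n (tau (a 0) x) := by
  induction n with
  | zero => rfl
  | succ n ih => rw [branch, ih, branch]

/-! ### Invariance of Lebesgue measure -/

theorem measurePreserving_T_iterate (n : ℕ) :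
    MeasurePreserving (T^[n]) (volume : Measure X) volume :=
  (AddCircle.ergodic_nsmul (T := (1 : ℝ)) (n := 2) (by norm_num)).toMeasurePreserving.iterate n

/-- The uniform probability on `{0, …, k-1}`. -/
def unif (k : ℕ) [NeZero k] : Measure (Fin k) := (PMF.uniformOfFintype (Fin k)).toMeasure

instance (k : ℕ) [NeZero k] : IsProbabilityMeasure (unif k) := by
  unfold unif; infer_instance

theorem integral_unif (k : ℕ) [NeZero k] (f : Fin k → ℝ) :
    ∫ i, f i ∂(unif k) = (1 / (k : ℝ)) * ∑ i, f i := by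
  rw [unif, PMF.integral_eq_sum, Finset.mul_sum]
  simp

theorem integral_tau {g : X → ℝ} (i : Fin 2) :
    ∫ x, g (tau i x) = 2 * ∫ t in ((i : ℕ) : ℝ) / 2..(1 / 2 + ((i : ℕ) : ℝ) / 2), g (t : X) := by
  rw [← UnitAddCircle.intervalIntegral_preimage 0 fun x => g (tau i x), zero_add]
  have h : ∫ t in (0 : ℝ)..1, g (tau i (t : X))
      = ∫ t in (0 : ℝ)..1, g ((t / 2 + ((i : ℕ) : ℝ) / 2 : ℝ) : X) := by
    refine intervalIntegral.integral_congr_Ioo_of_le zero_le_one fun t ht => ?_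
    simp only [tau_coe i ⟨ht.1.le, ht.2⟩]
  rw [h, intervalIntegral.integral_comp_div_add (fun t : ℝ => g (t : X)) two_ne_zero]
  simp

/-- A point drawn from Lebesgue measure stays Lebesgue distributed after a fair choice of an
inverse branch. -/
theorem integral_tau_average {g : X → ℝ} (hg : Continuous g) :
    ∑ i : Fin 2, ∫ x, g (tau i x) = 2 * ∫ x, g x := by
  have hc : Continuous fun t : ℝ => g (t : X) := hg.comp (AddCircle.continuous_mk' 1)
  have h := intervalIntegral.integral_add_adjacent_intervals
    (hc.intervalIntegrable (μ := volume) 0 (1 / 2)) (hc.intervalIntegrable (1 / 2) 1)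
  rw [← UnitAddCircle.intervalIntegral_preimage 0 g, zero_add, ← h]
  simp only [integral_tau, Fin.sum_univ_two]
  norm_num
  ring

theorem measurePreserving_tau :
    MeasurePreserving (fun p : Fin 2 × X => tau p.1 p.2) ((unif 2).prod volume) volume := by
  have hm : Measurable fun q : Fin 2 × X => tau q.1 q.2 :=
    measurable_from_prod_countable_right measurable_tau
  have := Measure.isProbabilityMeasure_map (μ := (unif 2).prod (volume : Measure X)) hm.aemeasurable
  refine ⟨hm, ext_of_forall_integral_eq_of_IsFiniteMeasure fun f => ?_⟩
  rw [integral_map hm.aemeasurable f.continuous.aestronglyMeasurable, integral_prod, integral_unif,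
    integral_tau_average f.continuous]
  · simp
  · exact Integrable.of_bound (f.continuous.measurable.comp hm).aestronglyMeasurable ‖f‖
      (ae_of_all _ fun p => f.norm_coe_le_norm _)

/-- Prepending an independent uniform symbol to a Bernoulli sequence gives a Bernoulli sequence. -/
theorem measurePreserving_cons (k : ℕ) [NeZero k] :
    MeasurePreserving (fun p : Fin k × (ℕ → Fin k) => fun n : ℕ => Nat.casesOn n p.1 p.2)
      ((unif k).prod (bernoulli k)) (bernoulli k) := by
  have hm : Measurable (fun p : Fin k × (ℕ → Fin k) => fun n : ℕ =>
      (Nat.casesOn n p.1 p.2 : Fin k)) := by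
    refine measurable_pi_iff.2 fun n => ?_
    cases n with
    | zero => exact measurable_fst
    | succ n => exact (measurable_pi_apply n).comp measurable_snd
  refine ⟨hm, Measure.eq_infinitePi _ fun s t ht => ?_⟩
  classical
  obtain ⟨N, hN⟩ := s.exists_nat_subset_range
  -- the box over `s` is rewritten as a box over an initial segment
  set t' : ℕ → Set (Fin k) := fun i => if i ∈ s then t i else Set.univ with ht'
  have hsN : s ⊆ Finset.range (N + 1) := hN.trans (Finset.range_mono (Nat.le_succ N))
  have hs : (s : Set ℕ).pi t = (Finset.range (N + 1) : Set ℕ).pi t' := by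
    ext f
    simp only [Set.mem_pi, ht', Finset.mem_coe]
    constructor
    · intro h i _
      split_ifs with hi
      · exact h i hi
      · trivial
    · intro h i hi
      simpa [hi] using h i (hsN hi)
  have hp : ∏ i ∈ s, (unif k) (t i) = ∏ i ∈ Finset.range (N + 1), (unif k) (t' i) := by
    rw [← Finset.prod_subset hsN]
    · exact Finset.prod_congr rfl fun i hi => by simp [ht', hi]
    · intro i _ hi
      simp [ht', hi]
  change _ = ∏ i ∈ s, (unif k) (t i)
  have hpre : (fun p : Fin k × (ℕ → Fin k) => fun n : ℕ => (Nat.casesOn n p.1 p.2 : Fin k)) ⁻¹'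
      (s : Set ℕ).pi t = t' 0 ×ˢ (Finset.range N : Set ℕ).pi fun i => t' (i + 1) := by
    rw [hs]
    ext p
    simp only [Set.mem_preimage, Set.mem_pi, Finset.coe_range, Set.mem_Iio, Set.mem_prod]
    constructor
    · exact fun h => ⟨h 0 (Nat.succ_pos N), fun i hi => h (i + 1) (Nat.succ_lt_succ hi)⟩
    · rintro ⟨h0, h1⟩ i hi
      cases i with
      | zero => exact h0
      | succ i => exact h1 i (Nat.lt_of_succ_lt_succ hi)
  rw [Measure.map_apply hm (MeasurableSet.pi s.countable_toSet fun i _ => ht i), hpre,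
    Measure.prod_prod, bernoulli, Measure.infinitePi_pi _ (fun i _ => MeasurableSet.of_discrete),
    hp, Finset.prod_range_succ', mul_comm]
  rfl

/-- The skew map `(a, x) ↦ (σ a, τ_{a_0} x)`, whose iterates carry the compositions of inverse
branches. -/
def skew (p : (ℕ → Fin 2) × X) : (ℕ → Fin 2) × X := (fun n => p.1 (n + 1), tau (p.1 0) p.2)

theorem snd_iterate_skew (n : ℕ) (p : (ℕ → Fin 2) × X) :
    (skew^[n] p).2 = branch p.1 n p.2 := by
  induction n generalizing p with
  | zero => rfl
  | succ n ih => rw [Function.iterate_succ_apply, ih, branch_succ']; rfl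

theorem measurePreserving_skew :
    MeasurePreserving skew ((bernoulli 2).prod volume) ((bernoulli 2).prod volume) := by
  have hm : Measurable skew := by
    refine Measurable.prodMk ?_ ?_
    · exact measurable_pi_iff.2 fun n => (measurable_pi_apply (n + 1)).comp measurable_fst
    · exact (measurable_branch 1)
  have hcons := (measurePreserving_cons 2).prod (MeasurePreserving.id (volume : Measure X))
  refine ⟨hm, ?_⟩
  conv_lhs => rw [← hcons.map_eq]
  rw [Measure.map_map hm hcons.measurable]
  have h1 : MeasurePreserving
      (fun p : (Fin 2 × (ℕ → Fin 2)) × X => (p.1.2, (p.1.1, p.2)))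
      (((unif 2).prod (bernoulli 2)).prod volume) ((bernoulli 2).prod ((unif 2).prod volume)) := by
    have e1 : MeasurePreserving (Prod.swap : Fin 2 × (ℕ → Fin 2) → _)
      ((unif 2).prod (bernoulli 2)) ((bernoulli 2).prod (unif 2)) := Measure.measurePreserving_swap
    exact (measurePreserving_prodAssoc (bernoulli 2) (unif 2) (volume : Measure X)).comp
      (e1.prod (MeasurePreserving.id (volume : Measure X)))
  exact (((MeasurePreserving.id (bernoulli 2)).prod measurePreserving_tau).comp h1).map_eq

/-- For a Lebesgue point `x` and an independent fair sequence of branches, the point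
`τ_{a_{n-1}} ∘ ⋯ ∘ τ_{a_0} (x)` is again Lebesgue distributed. -/
theorem measurePreserving_branch (n : ℕ) :
    MeasurePreserving (fun p : (ℕ → Fin 2) × X => branch p.1 n p.2)
      ((bernoulli 2).prod volume) volume := by
  have h := measurePreserving_snd.comp (measurePreserving_skew.iterate n)
  have e : (Prod.snd ∘ skew^[n]) = fun p : (ℕ → Fin 2) × X => branch p.1 n p.2 :=
    funext fun p => snd_iterate_skew n p
  rwa [e] at h

theorem measurePreserving_eval_bernoulli (k : ℕ) [NeZero k] (i : ℕ) :
    MeasurePreserving (fun c : ℕ → Fin k => c i) (bernoulli k) (unif k) :=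
  measurePreserving_eval_infinitePi (fun _ : ℕ => (PMF.uniformOfFintype (Fin k)).toMeasure) i

/-! ### A law of large numbers under decay of correlations -/

section LawOfLargeNumbers

variable {Ω : Type*} [MeasurableSpace Ω] {P : Measure Ω}
  {Y : ℕ → Ω → ℝ} {B C : ℝ}

theorem sum_range_half_pow_sub_le_one (N : ℕ) :
    ∑ i ∈ Finset.range N, (1 / 2 : ℝ) ^ (N - i) ≤ 1 := by
  suffices h : ∑ i ∈ Finset.range N, (1 / 2 : ℝ) ^ (N - i) = 1 - (1 / 2) ^ N by
    rw [h]; linarith [pow_pos (one_half_pos (α := ℝ)) N]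
  induction N with
  | zero => simp
  | succ N ih =>
    have h : ∀ i ∈ Finset.range N, (1 / 2 : ℝ) ^ (N + 1 - i) = (1 / 2) ^ (N - i) * (1 / 2) := by
      intro i hi
      rw [Nat.succ_sub (Finset.mem_range.mp hi).le, pow_succ]
    rw [Finset.sum_range_succ, Finset.sum_congr rfl h, ← Finset.sum_mul, ih, pow_succ]
    norm_num
    ring

/-- Summable correlations make the variance of the partial sums grow at most linearly. -/
theorem integral_sq_sum_le [IsProbabilityMeasure P] (hY : ∀ n, Measurable (Y n))
    (hB : ∀ n ω, |Y n ω| ≤ B) (hC : 0 ≤ C)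
    (hcorr : ∀ i j, i < j → |∫ ω, Y i ω * Y j ω ∂P| ≤ C * (1 / 2) ^ (j - i)) (N : ℕ) :
    ∫ ω, (∑ i ∈ Finset.range N, Y i ω) ^ 2 ∂P ≤ (B ^ 2 + 2 * C) * N := by
  have hint : ∀ i j, Integrable (fun ω => Y i ω * Y j ω) P := fun i j =>
    Integrable.of_bound ((hY i).mul (hY j)).aestronglyMeasurable (B * B) (ae_of_all _ fun ω => by
      rw [Real.norm_eq_abs, abs_mul]
      exact mul_le_mul (hB i ω) (hB j ω) (abs_nonneg _) ((abs_nonneg _).trans (hB i ω)))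
  have hsum : ∀ n, Integrable (fun ω => (∑ i ∈ Finset.range n, Y i ω) ^ 2) P := by
    intro n
    simp only [sq, Finset.sum_mul_sum]
    exact integrable_finsetSum _ fun i _ => integrable_finsetSum _ fun j _ => hint i j
  induction N with
  | zero => simp
  | succ N ih =>
    have hcross : Integrable (fun ω => ∑ i ∈ Finset.range N, Y i ω * Y N ω) P :=
      integrable_finsetSum _ fun i _ => hint i N
    have e : ∀ ω, (∑ i ∈ Finset.range (N + 1), Y i ω) ^ 2 = (∑ i ∈ Finset.range N, Y i ω) ^ 2
        + (2 * ∑ i ∈ Finset.range N, Y i ω * Y N ω) + Y N ω * Y N ω := by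
      intro ω
      rw [Finset.sum_range_succ, ← Finset.sum_mul]; ring
    simp only [e]
    have hadd : Integrable (fun ω => (∑ i ∈ Finset.range N, Y i ω) ^ 2
        + 2 * ∑ i ∈ Finset.range N, Y i ω * Y N ω) P := (hsum N).add (hcross.const_mul 2)
    rw [integral_add hadd (hint N N),
      integral_add (hsum N) (hcross.const_mul 2), integral_const_mul,
      integral_finsetSum _ fun i _ => hint i N]
    have h1 : ∑ i ∈ Finset.range N, ∫ ω, Y i ω * Y N ω ∂P ≤ C := by
      calc ∑ i ∈ Finset.range N, ∫ ω, Y i ω * Y N ω ∂P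
          ≤ ∑ i ∈ Finset.range N, C * (1 / 2) ^ (N - i) := Finset.sum_le_sum fun i hi =>
            (le_abs_self _).trans (hcorr i N (Finset.mem_range.mp hi))
        _ = C * ∑ i ∈ Finset.range N, (1 / 2 : ℝ) ^ (N - i) := by rw [Finset.mul_sum]
        _ ≤ C := mul_le_of_le_one_right hC (sum_range_half_pow_sub_le_one N)
    have h2 : ∫ ω, Y N ω * Y N ω ∂P ≤ B ^ 2 := by
      have h := integral_mono (hint N N) (integrable_const (μ := P) (B ^ 2)) fun ω => by
        change Y N ω * Y N ω ≤ B ^ 2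
        rw [← sq]; exact sq_le_sq' (neg_le_of_abs_le (hB N ω)) (le_of_abs_le (hB N ω))
      simpa using h
    push_cast
    linarith

/-- A sequence of nonnegative functions with summable integrals tends to `0` almost everywhere. -/
theorem ae_tendsto_zero_of_summable_integral {g : ℕ → Ω → ℝ} (hg : ∀ n, Integrable (g n) P)
    (hg0 : ∀ n ω, 0 ≤ g n ω) (hs : Summable fun n => ∫ ω, g n ω ∂P) :
    ∀ᵐ ω ∂P, Tendsto (fun n => g n ω) atTop (𝓝 0) := by
  have hm : ∀ n, AEMeasurable (fun ω => ENNReal.ofReal (g n ω)) P := fun n =>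
    (hg n).aemeasurable.ennreal_ofReal
  have hfin : ∫⁻ ω, ∑' n, ENNReal.ofReal (g n ω) ∂P ≠ ⊤ := by
    rw [lintegral_tsum hm]
    simp only [← ofReal_integral_eq_lintegral_ofReal (hg _) (ae_of_all _ (hg0 _))]
    exact hs.tsum_ofReal_ne_top
  filter_upwards [ae_lt_top' (AEMeasurable.tsum hm) hfin] with ω hω
  have h := (ENNReal.tendsto_toReal ENNReal.zero_ne_top).comp
    (ENNReal.tendsto_atTop_zero_of_tsum_ne_top hω.ne)
  simpa [Function.comp_def, ENNReal.toReal_ofReal (hg0 _ ω)] using h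

/-- For a bounded sequence, convergence to `0` of the averages along the squares implies
convergence of all averages, since consecutive squares `k²`, `(k+1)²` are only `O(k)` apart. -/
theorem tendsto_average_of_tendsto_sq {y : ℕ → ℝ} (hB : ∀ n, |y n| ≤ B)
    (h : Tendsto (fun k : ℕ => (∑ i ∈ Finset.range (k ^ 2), y i) / (k : ℝ) ^ 2) atTop (𝓝 0)) :
    Tendsto (fun N : ℕ => (∑ i ∈ Finset.range N, y i) / (N : ℝ)) atTop (𝓝 0) := by
  have hB0 : 0 ≤ B := (abs_nonneg _).trans (hB 0)
  have hu : Tendsto (fun k : ℕ => |(∑ i ∈ Finset.range (k ^ 2), y i) / (k : ℝ) ^ 2|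
      + 2 * B / (k : ℝ)) atTop (𝓝 0) := by
    simpa using h.abs.add (tendsto_const_div_atTop_nhds_zero_nat (2 * B))
  have hsq : Tendsto Nat.sqrt atTop atTop :=
    tendsto_atTop_atTop.2 fun b => ⟨b ^ 2, fun n hn => Nat.le_sqrt'.2 hn⟩
  refine squeeze_zero_norm' ?_ (hu.comp hsq)
  filter_upwards [eventually_ge_atTop 1] with N hN
  set k := Nat.sqrt N with hk
  have hk1 : 1 ≤ k := Nat.le_sqrt'.2 (by simpa using hN)
  have hkN : k ^ 2 ≤ N := Nat.sqrt_le' N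
  have hNk : N ≤ k ^ 2 + 2 * k := by
    have := Nat.sqrt_le_add N
    rw [← hk] at this
    rw [sq]; omega
  have hk0 : (0 : ℝ) < k := by exact_mod_cast hk1
  have hkN' : ((k : ℝ)) ^ 2 ≤ N := by exact_mod_cast hkN
  have hdiff : |∑ i ∈ Finset.Ico (k ^ 2) N, y i| ≤ 2 * k * B := by
    calc |∑ i ∈ Finset.Ico (k ^ 2) N, y i| ≤ ∑ i ∈ Finset.Ico (k ^ 2) N, |y i| :=
          Finset.abs_sum_le_sum_abs _ _
      _ ≤ ∑ _i ∈ Finset.Ico (k ^ 2) N, B := Finset.sum_le_sum fun i _ => hB i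
      _ = ((N - k ^ 2 : ℕ) : ℝ) * B := by simp
      _ ≤ 2 * k * B := by
          refine mul_le_mul_of_nonneg_right ?_ hB0
          exact_mod_cast Nat.sub_le_iff_le_add'.2 hNk
  simp only [Function.comp]
  rw [Real.norm_eq_abs, abs_div, Nat.abs_cast, abs_div, abs_of_pos (pow_pos hk0 2)]
  calc |∑ i ∈ Finset.range N, y i| / N
      ≤ (|∑ i ∈ Finset.range (k ^ 2), y i| + 2 * k * B) / N := by
        refine div_le_div_of_nonneg_right ?_ (Nat.cast_nonneg _)
        rw [← Finset.sum_range_add_sum_Ico _ hkN]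
        exact (abs_add_le _ _).trans (by linarith)
    _ ≤ (|∑ i ∈ Finset.range (k ^ 2), y i| + 2 * k * B) / (k : ℝ) ^ 2 := by
        gcongr
    _ = |∑ i ∈ Finset.range (k ^ 2), y i| / (k : ℝ) ^ 2 + 2 * B / k := by
        field_simp

/-- A strong law of large numbers: bounded variables whose correlations decay exponentially have
averages tending to `0` almost surely. The second moments give convergence along the squares, and
boundedness fills the gaps. -/
theorem ae_tendsto_average_zero [IsProbabilityMeasure P] (hY : ∀ n, Measurable (Y n))
    (hB : ∀ n ω, |Y n ω| ≤ B) (hC : 0 ≤ C)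
    (hcorr : ∀ i j, i < j → |∫ ω, Y i ω * Y j ω ∂P| ≤ C * (1 / 2) ^ (j - i)) :
    ∀ᵐ ω ∂P, Tendsto (fun N : ℕ => (∑ i ∈ Finset.range N, Y i ω) / (N : ℝ)) atTop (𝓝 0) := by
  have hSm : ∀ n, Measurable fun ω => ∑ i ∈ Finset.range n, Y i ω := fun n =>
    Finset.measurable_fun_sum _ fun i _ => hY i
  have hSb : ∀ n ω, |∑ i ∈ Finset.range n, Y i ω| ≤ n * B := fun n ω => by
    calc |∑ i ∈ Finset.range n, Y i ω| ≤ ∑ i ∈ Finset.range n, |Y i ω| :=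
          Finset.abs_sum_le_sum_abs _ _
      _ ≤ ∑ _i ∈ Finset.range n, B := Finset.sum_le_sum fun i _ => hB i ω
      _ = n * B := by simp
  set g : ℕ → Ω → ℝ := fun k ω => ((∑ i ∈ Finset.range (k ^ 2), Y i ω) / (k : ℝ) ^ 2) ^ 2 with hg
  have hgi : ∀ k, Integrable (g k) P := fun k => by
    refine Integrable.of_bound (((hSm _).div_const _).pow_const 2).aestronglyMeasurable
      ((((k ^ 2 : ℕ) : ℝ) * B / (k : ℝ) ^ 2) ^ 2) (ae_of_all _ fun ω => ?_)
    rw [Real.norm_eq_abs, hg, abs_pow, abs_div, abs_of_nonneg (by positivity : (0:ℝ) ≤ (k:ℝ) ^ 2)]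
    have := hSb (k ^ 2) ω
    gcongr
  have hgs : Summable fun k => ∫ ω, g k ω ∂P := by
    refine Summable.of_nonneg_of_le (fun k => integral_nonneg fun ω => sq_nonneg _) (fun k => ?_)
      ((Real.summable_one_div_nat_pow.2 one_lt_two).mul_left (B ^ 2 + 2 * C))
    have h := integral_sq_sum_le hY hB hC hcorr (k ^ 2)
    simp only [hg, div_pow, integral_div]
    rcases Nat.eq_zero_or_pos k with rfl | hk
    · simp
    have hk0 : (0 : ℝ) < k := by exact_mod_cast hk
    rw [div_le_iff₀ (by positivity)]
    refine h.trans (le_of_eq ?_)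
    push_cast
    field_simp
  filter_upwards [ae_tendsto_zero_of_summable_integral hgi (fun k ω => sq_nonneg _) hgs] with ω hω
  refine tendsto_average_of_tendsto_sq (fun n => hB n ω) ?_
  have h := hω.sqrt
  simp only [hg, Real.sqrt_sq_eq_abs, Real.sqrt_zero] at h
  exact (tendsto_zero_iff_abs_tendsto_zero _).2 h

end LawOfLargeNumbers

/-! ### Decay of correlations for the doubling map -/

/-- Exponential decay of correlations of a Lipschitz function with zero mean. The transfer operator
is the average over the inverse branches: `x = T^n y` for `y` the image of `x` under a random branch
of order `n`, and these images of two points are `2⁻ⁿ`-close. -/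
theorem abs_integral_mul_comp_iterate_le {g : X → ℝ} {K : ℝ≥0} {M : ℝ} (hg : LipschitzWith K g)
    (hM : ∀ x, |g x| ≤ M) (h0 : ∫ x, g x = 0) (n : ℕ) :
    |∫ x, g x * g (T^[n] x)| ≤ M * K * (1 / 2) ^ n := by
  have hM0 : 0 ≤ M := (abs_nonneg _).trans (hM 0)
  have hgm : Measurable g := hg.continuous.measurable
  have hb := measurePreserving_branch n
  have hT : Measurable (T^[n]) := (measurePreserving_T_iterate n).measurable
  have hga : ∀ x, Integrable (fun a : ℕ → Fin 2 => g (branch a n x)) (bernoulli 2) := fun x =>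
    Integrable.of_bound (hgm.comp ((measurable_branch n).comp
      (measurable_id.prodMk measurable_const))).aestronglyMeasurable M
      (ae_of_all _ fun a => hM _)
  have hgp : Integrable (fun p : X × (ℕ → Fin 2) => g (branch p.2 n p.1))
      ((volume : Measure X).prod (bernoulli 2)) :=
    Integrable.of_bound (hgm.comp (hb.measurable.comp measurable_swap)).aestronglyMeasurable M
      (ae_of_all _ fun a => hM _)
  have hgpm : Integrable (fun p : X × (ℕ → Fin 2) => g (branch p.2 n p.1) * g p.1)
      ((volume : Measure X).prod (bernoulli 2)) :=
    hgp.mul_bdd (c := M) (hgm.comp measurable_fst).aestronglyMeasurable (ae_of_all _ fun p => hM _)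
  have hbs : MeasurePreserving (fun p : X × (ℕ → Fin 2) => branch p.2 n p.1)
      ((volume : Measure X).prod (bernoulli 2)) volume := hb.comp Measure.measurePreserving_swap
  -- the transfer operator applied to `g`
  set L : X → ℝ := fun x => ∫ a, g (branch a n x) ∂(bernoulli 2) with hL
  have hLi : Integrable L := hgp.integral_prod_left
  have hL0 : ∫ x, L x = 0 := by
    rw [← h0, ← hbs.map_eq, integral_map hbs.aemeasurable hgm.aestronglyMeasurable, hbs.map_eq,
      integral_prod _ hgp]
  have hLdist : ∀ x y, |L x - L y| ≤ K * (1 / 2) ^ n := by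
    intro x y
    rw [hL, ← integral_sub (hga x) (hga y)]
    have h := norm_integral_le_of_norm_le_const (μ := bernoulli 2)
      (f := fun a => g (branch a n x) - g (branch a n y)) (C := K * (1 / 2) ^ n)
      (ae_of_all _ fun a => by
        rw [← dist_eq_norm]
        exact (hg.dist_le_mul _ _).trans
          (mul_le_mul_of_nonneg_left (dist_branch_le a n x y) K.coe_nonneg))
    simpa using h
  have hLb : ∀ x, |L x| ≤ K * (1 / 2) ^ n := by
    intro x
    have e : L x = ∫ y, (L x - L y) := by
      rw [integral_sub (integrable_const _) hLi, hL0]; simp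
    rw [e]
    have h := norm_integral_le_of_norm_le_const (μ := (volume : Measure X))
      (f := fun y => L x - L y) (C := K * (1 / 2) ^ n) (ae_of_all _ fun y => hLdist x y)
    simpa using h
  have e : ∫ x, g x * g (T^[n] x) = ∫ x, L x * g x := by
    have hgT : Measurable fun x => g x * g (T^[n] x) := hgm.mul (hgm.comp hT)
    conv_lhs => rw [← hbs.map_eq]
    rw [integral_map hbs.aemeasurable hgT.aestronglyMeasurable]
    simp only [iterate_T_branch]
    rw [integral_prod _ hgpm]
    simp only [integral_mul_const, hL]
  rw [e]
  have h := norm_integral_le_of_norm_le_const (μ := (volume : Measure X))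
    (f := fun x => L x * g x) (C := M * K * (1 / 2) ^ n) (ae_of_all _ fun x => by
      rw [Real.norm_eq_abs, abs_mul, mul_comm, mul_assoc]
      exact mul_le_mul (hM x) (hLb x) (abs_nonneg _) hM0)
  simpa using h

/-- Distinct entries of a Bernoulli sequence are independent. -/
theorem integral_eval_mul_eval (k : ℕ) [NeZero k] {i j : ℕ} (hij : i ≠ j) (f g : Fin k → ℝ) :
    ∫ b, f (b i) * g (b j) ∂(bernoulli k) = (∫ c, f c ∂(unif k)) * ∫ c, g c ∂(unif k) := by
  have hind := (ProbabilityTheory.iIndepFun_infinitePi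
    (P := fun _ : ℕ => (PMF.uniformOfFintype (Fin k)).toMeasure) (X := fun _ c => c)
    (fun _ => measurable_id)).indepFun hij
  have hi := measurePreserving_eval_bernoulli k i
  have hj := measurePreserving_eval_bernoulli k j
  have h := hind.integral_fun_comp_mul_comp (f := f) (g := g)
    (measurable_pi_apply i).aemeasurable (measurable_pi_apply j).aemeasurable
    (measurable_of_finite f).aestronglyMeasurable (measurable_of_finite g).aestronglyMeasurable
  refine h.trans ?_
  rw [← hi.map_eq, integral_map hi.aemeasurable (measurable_of_finite f).aestronglyMeasurable,
    hi.map_eq, ← hj.map_eq, integral_map hj.aemeasurable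
      (measurable_of_finite g).aestronglyMeasurable]
  rfl

/-! ### The observable and its mean -/

/-- The mean `(1/m) ∑_c ∫ A_c dℓ` of the observables over a uniform symbol `c` and a Lebesgue point
of the circle. -/
def meanObs [NeZero m] (A : Fin m → X → ℝ) : ℝ :=
  ∫ x, ∫ c, A c x ∂(unif m)

theorem exists_abs_le (A : Fin m → X → ℝ) (hA : ∀ c, Continuous (A c)) :
    ∃ M : ℝ, 0 ≤ M ∧ ∀ c x, |A c x| ≤ M := by
  choose M hM using fun c => (isCompact_univ (X := X)).exists_bound_of_continuousOn
    (hA c).continuousOn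
  refine ⟨∑ c, |M c|, Finset.sum_nonneg fun _ _ => abs_nonneg _, fun c x => ?_⟩
  exact ((hM c x trivial).trans (le_abs_self _)).trans
    (Finset.single_le_sum (f := fun c => |M c|) (fun _ _ => abs_nonneg _) (Finset.mem_univ c))

theorem measurable_uncurry_obs {A : Fin m → X → ℝ} (hA : ∀ c, Measurable (A c)) :
    Measurable fun q : X × Fin m => A q.2 q.1 :=
  (measurable_from_prod_countable_right (f := fun q : Fin m × X => A q.1 q.2) hA).comp
    measurable_swap

theorem integrable_obs_prod [NeZero m] {A : Fin m → X → ℝ} (hA : ∀ c, Continuous (A c)) :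
    Integrable (fun q : X × Fin m => A q.2 q.1) ((volume : Measure X).prod (unif m)) := by
  obtain ⟨M, -, hM⟩ := exists_abs_le A hA
  exact Integrable.of_bound
    (measurable_uncurry_obs fun c => (hA c).measurable).aestronglyMeasurable M
    (ae_of_all _ fun q => hM _ _)

theorem integral_obs_prod [NeZero m] {A : Fin m → X → ℝ} (hA : ∀ c, Continuous (A c)) :
    ∫ q : X × Fin m, A q.2 q.1 ∂((volume : Measure X).prod (unif m)) = meanObs A := by
  rw [meanObs, integral_prod _ (integrable_obs_prod hA)]

/-- The observable evaluated at a measure-preserving image of the base space has the same mean. -/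
theorem integral_obs_comp [NeZero m] {A : Fin m → X → ℝ} (hA : ∀ c, Continuous (A c))
    {Ω : Type*} [MeasurableSpace Ω] {Q : Measure Ω} {f : Ω → X × Fin m}
    (hf : MeasurePreserving f Q ((volume : Measure X).prod (unif m))) :
    ∫ ω, A (f ω).2 (f ω).1 ∂Q = meanObs A := by
  rw [← integral_obs_prod hA, ← hf.map_eq, integral_map hf.aemeasurable
    (measurable_uncurry_obs fun c => (hA c).measurable).aestronglyMeasurable]

/-! ### Convergence of the averages -/

/-- For almost every point and symbol sequence, the averages converge to the mean observable. -/
theorem ae_tendsto_orbitAverage [NeZero m] {A : Fin m → X → ℝ}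
    (hA : ∀ c, ∃ K : ℝ≥0, LipschitzWith K (A c)) :
    ∀ᵐ q ∂((volume : Measure X).prod (bernoulli m)),
      Tendsto (fun N : ℕ => orbitAverage A q.1 q.2 N) atTop (𝓝 (meanObs A)) := by
  choose K hK using hA
  have hc : ∀ c, Continuous (A c) := fun c => (hK c).continuous
  obtain ⟨M, hM0, hM⟩ := exists_abs_le A hc
  set μ₀ := meanObs A with hμ
  have hμM : |μ₀| ≤ M := by
    rw [hμ, ← integral_obs_prod hc]
    have h := norm_integral_le_of_norm_le_const (μ := (volume : Measure X).prod (unif m))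
      (f := fun q : X × Fin m => A q.2 q.1) (C := M) (ae_of_all _ fun q => hM _ _)
    simpa using h
  set Z : Fin m → X → ℝ := fun c x => A c x - μ₀ with hZ
  have hZM : ∀ c x, |Z c x| ≤ 2 * M := fun c x =>
    (abs_sub _ _).trans (by linarith [hM c x])
  have hZm : ∀ c, Measurable (Z c) := fun c => ((hc c).sub continuous_const).measurable
  -- the average of the centered observables over the symbols
  set g : X → ℝ := fun x => ∫ c, Z c x ∂(unif m) with hg
  have hgL : LipschitzWith (∑ c, K c) g := by
    refine LipschitzWith.of_dist_le_mul fun x y => ?_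
    rw [dist_eq_norm, hg, ← integral_sub (Integrable.of_finite) (Integrable.of_finite)]
    have h := norm_integral_le_of_norm_le_const (μ := unif m)
      (f := fun c => Z c x - Z c y) (C := ((∑ c, K c : ℝ≥0) : ℝ) * dist x y)
      (ae_of_all _ fun c => by
        simp only [hZ, sub_sub_sub_cancel_right, ← dist_eq_norm]
        refine ((hK c).dist_le_mul x y).trans (mul_le_mul_of_nonneg_right ?_ dist_nonneg)
        exact_mod_cast Finset.single_le_sum (f := K) (fun _ _ => zero_le) (Finset.mem_univ c))
    simpa using h
  have hgM : ∀ x, |g x| ≤ 2 * M := fun x => by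
    have h := norm_integral_le_of_norm_le_const (μ := unif m)
      (f := fun c => Z c x) (C := 2 * M) (ae_of_all _ fun c => hZM c x)
    simpa using h
  have hg0 : ∫ x, g x = 0 := by
    have hgA : ∀ x, g x = (∫ c, A c x ∂(unif m)) - μ₀ := fun x => by
      rw [hg]; simp only [hZ]
      rw [integral_sub Integrable.of_finite Integrable.of_finite]; simp
    simp only [hgA]
    rw [integral_sub (integrable_obs_prod hc).integral_prod_left (integrable_const _)]
    simp [hμ, meanObs]
  set Y : ℕ → X × (ℕ → Fin m) → ℝ := fun n q => Z (q.2 n) (T^[n] q.1) with hY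
  have hYm : ∀ n, Measurable (Y n) := fun n =>
    (measurable_uncurry_obs hZm).comp (((measurePreserving_T_iterate n).measurable.comp
      measurable_fst).prodMk ((measurable_pi_apply n).comp measurable_snd))
  have hcorr : ∀ i j, i < j →
      |∫ q, Y i q * Y j q ∂((volume : Measure X).prod (bernoulli m))|
        ≤ (2 * M * (∑ c, K c : ℝ≥0)) * (1 / 2) ^ (j - i) := by
    intro i j hij
    have hint : Integrable (fun q => Y i q * Y j q) ((volume : Measure X).prod (bernoulli m)) :=
      Integrable.of_bound ((hYm i).mul (hYm j)).aestronglyMeasurable (2 * M * (2 * M))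
        (ae_of_all _ fun q => by
          rw [Real.norm_eq_abs, abs_mul]
          exact mul_le_mul (hZM _ _) (hZM _ _) (abs_nonneg _) (by positivity))
    have e : ∫ q, Y i q * Y j q ∂((volume : Measure X).prod (bernoulli m))
        = ∫ x, g x * g (T^[j - i] x) := by
      have hT := measurePreserving_T_iterate i
      have hgc := hgL.continuous.measurable
      have hm' : Measurable fun x => g x * g (T^[j - i] x) :=
        hgc.mul (hgc.comp (measurePreserving_T_iterate (j - i)).measurable)
      rw [integral_prod _ hint]
      conv_rhs => rw [← hT.map_eq]
      rw [integral_map hT.aemeasurable hm'.aestronglyMeasurable]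
      refine integral_congr_ae (ae_of_all _ fun x => ?_)
      simp only [hY]
      rw [integral_eval_mul_eval m hij.ne (fun c => Z c (T^[i] x)) (fun c => Z c (T^[j] x)),
        ← Function.iterate_add_apply, Nat.sub_add_cancel hij.le]
    rw [e]
    exact abs_integral_mul_comp_iterate_le hgL hgM hg0 (j - i)
  filter_upwards [ae_tendsto_average_zero hYm (fun n q => hZM _ _) (by positivity) hcorr] with q hq
  have hlast : Tendsto (fun N : ℕ => A (q.2 (N - 1)) (T^[N - 1] q.1) / (N : ℝ)) atTop (𝓝 0) := by
    refine squeeze_zero_norm (fun N => ?_) (tendsto_const_div_atTop_nhds_zero_nat M)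
    rw [Real.norm_eq_abs, abs_div, Nat.abs_cast]
    exact div_le_div_of_nonneg_right (hM _ _) (Nat.cast_nonneg _)
  have hlim := (hq.add_const μ₀).sub hlast
  rw [zero_add, sub_zero] at hlim
  refine hlim.congr' ?_
  filter_upwards [eventually_ge_atTop 1] with N hN
  obtain ⟨n, rfl⟩ := Nat.exists_eq_add_of_le' hN
  have hn : ((n + 1 : ℕ) : ℝ) ≠ 0 := by positivity
  rw [orbitAverage, Finset.sum_Ico_eq_sum_range]
  simp only [hY, hZ, Finset.sum_sub_distrib, Finset.sum_const, Finset.card_range, nsmul_eq_mul,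
    Nat.add_sub_cancel, Nat.add_sub_cancel_left, Finset.sum_range_succ _ n]
  field_simp
  push_cast
  ring

/-! ### The random SRB measure -/

theorem measurePreserving_srb [NeZero m] {A : Fin m → X → ℝ} (hA : ∀ c, Measurable (A c))
    (lam : ℝ) :
    MeasurePreserving (fun p : X × ℝ × (ℕ → Fin m) => (p.1, p.2.2)) (srb A lam)
      ((volume : Measure X).prod (bernoulli m)) := by
  have hm : Measurable (fun p : X × ℝ × (ℕ → Fin m) => (p.1, p.2.2)) :=
    measurable_fst.prodMk measurable_snd.snd
  refine ⟨hm, ?_⟩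
  rw [srb, Measure.map_map hm (measurable_Psi hA lam)]
  exact ((MeasurePreserving.id (volume : Measure X)).prod
    ((measurePreserving_snd (μ := bernoulli m) (ν := bernoulli m)).comp
      (measurePreserving_snd (μ := bernoulli 2)))).map_eq

/-- An almost sure property of `(x, b)` holds on the projection of a measurable set of full
`μ`-measure. -/
theorem exists_full_measure_of_ae [NeZero m] {A : Fin m → X → ℝ} (hA : ∀ c, Measurable (A c))
    (lam : ℝ) {p : X × (ℕ → Fin m) → Prop}
    (h : ∀ᵐ q ∂((volume : Measure X).prod (bernoulli m)), p q) :
    ∃ Ω : Set (X × ℝ × (ℕ → Fin m)), MeasurableSet Ω ∧ srb A lam Ω = 1 ∧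
      ∀ q ∈ (fun p : X × ℝ × (ℕ → Fin m) => (p.1, p.2.2)) '' Ω, p q := by
  obtain ⟨s, hs, hsm, hp⟩ := h.exists_measurable_mem
  have hmp := measurePreserving_srb hA lam
  refine ⟨_, hmp.measurable hsm, ?_, ?_⟩
  · rw [hmp.measure_preimage hsm.nullMeasurableSet]
    exact (prob_compl_eq_zero_iff hsm).1 hs
  · rintro _ ⟨w, hw, rfl⟩
    exact hp _ hw

/-- The product measure `ℓ × η × ν × ν` whose image is the SRB measure. -/
abbrev base (m : ℕ) [NeZero m] : Measure (X × (ℕ → Fin 2) × (ℕ → Fin m) × (ℕ → Fin m)) :=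
  (volume : Measure X).prod ((bernoulli 2).prod ((bernoulli m).prod (bernoulli m)))

theorem measurePreserving_branch_eval [NeZero m] (i : ℕ) :
    MeasurePreserving (fun p : X × (ℕ → Fin 2) × (ℕ → Fin m) × (ℕ → Fin m) =>
      (branch p.2.1 (i + 1) p.1, p.2.2.1 i)) (base m) ((volume : Measure X).prod (unif m)) := by
  have h1 := (measurePreserving_prodAssoc (volume : Measure X) (bernoulli 2)
    ((bernoulli m).prod (bernoulli m))).symm
  have h2 := ((measurePreserving_branch (i + 1)).comp
    (Measure.measurePreserving_swap (μ := (volume : Measure X)) (ν := bernoulli 2))).prod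
    ((measurePreserving_eval_bernoulli m i).comp
      (measurePreserving_fst (μ := bernoulli m) (ν := bernoulli m)))
  exact h2.comp h1

section Series

variable {A : Fin m → X → ℝ} {lam M : ℝ}

theorem abs_term_le (hl : 0 < lam) (hM : ∀ c x, |A c x| ≤ M) (i : ℕ) (c : Fin m) (x : X) :
    ‖lam ^ i * A c x‖ ≤ M * lam ^ i := by
  rw [Real.norm_eq_abs, abs_mul, abs_of_pos (pow_pos hl i), mul_comm]
  exact mul_le_mul_of_nonneg_right (hM c x) (pow_pos hl i).le

theorem abs_S_le (hl : 0 < lam) (hl1 : lam < 1) (hM : ∀ c x, |A c x| ≤ M) (x : X)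
    (c : ℕ → Fin m) (a : ℕ → Fin 2) : |S A lam x c a| ≤ M * (1 - lam)⁻¹ :=
  tsum_of_norm_bounded ((hasSum_geometric_of_lt_one hl.le hl1).mul_left M)
    fun i => abs_term_le hl hM i _ _

theorem measurable_S_Psi (hA : ∀ c, Measurable (A c)) :
    Measurable fun p : X × (ℕ → Fin 2) × (ℕ → Fin m) × (ℕ → Fin m) =>
      S A lam p.1 p.2.2.1 p.2.1 := (measurable_Psi hA lam).snd.fst

theorem integrable_S [NeZero m] (hA : ∀ c, Measurable (A c)) (hl : 0 < lam) (hl1 : lam < 1)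
    (hM : ∀ c x, |A c x| ≤ M) :
    Integrable (fun p => S A lam p.1 p.2.2.1 p.2.1) (base m) :=
  Integrable.of_bound (measurable_S_Psi hA).aestronglyMeasurable _
    (ae_of_all _ fun _ => abs_S_le hl hl1 hM _ _ _)

/-- Each term of the series has mean `λ^i` times the mean observable, as the random branches
preserve Lebesgue measure. -/
theorem integral_S [NeZero m] (hA : ∀ c, Continuous (A c)) (hl : 0 < lam) (hl1 : lam < 1) :
    ∫ p, S A lam p.1 p.2.2.1 p.2.1 ∂(base m) = (1 - lam)⁻¹ * meanObs A := by
  obtain ⟨M, hM0, hM⟩ := exists_abs_le A hA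
  set F : ℕ → X × (ℕ → Fin 2) × (ℕ → Fin m) × (ℕ → Fin m) → ℝ := fun i p =>
    lam ^ i * A (p.2.2.1 i) (branch p.2.1 (i + 1) p.1) with hF
  have hFi : ∀ i, Integrable (F i) (base m) := fun i =>
    Integrable.of_bound (((measurable_uncurry_obs fun c => (hA c).measurable).comp
      (measurePreserving_branch_eval i).measurable).const_mul _).aestronglyMeasurable
      (M * lam ^ i) (ae_of_all _ fun p => abs_term_le hl hM i _ _)
  have hsum : Summable fun i => ∫ p, ‖F i p‖ ∂(base m) := by
    refine Summable.of_nonneg_of_le (fun i => integral_nonneg fun p => norm_nonneg _) (fun i => ?_)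
      ((summable_geometric_of_lt_one hl.le hl1).mul_left M)
    have h := integral_mono (hFi i).norm (integrable_const (M * lam ^ i))
      fun _ => abs_term_le hl hM i _ _
    simpa using h
  have h := (hasSum_integral_of_summable_integral_norm hFi hsum).tsum_eq
  have hval : ∀ i, ∫ p, F i p ∂(base m) = lam ^ i * meanObs A := fun i => by
    rw [hF, integral_const_mul, integral_obs_comp hA (measurePreserving_branch_eval i)]
  simp only [hval, tsum_mul_right, tsum_geometric_of_lt_one hl.le hl1] at h
  exact h.symm

theorem integral_snd_srb [NeZero m] (hA : ∀ c, Measurable (A c)) :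
    ∫ p, p.2.1 ∂(srb A lam) = ∫ p, S A lam p.1 p.2.2.1 p.2.1 ∂(base m) := by
  rw [srb, integral_map (measurable_Psi hA lam).aemeasurable
    measurable_snd.fst.aestronglyMeasurable]
  rfl

theorem integrable_snd_srb [NeZero m] (hA : ∀ c, Measurable (A c)) (hl : 0 < lam) (hl1 : lam < 1)
    (hM : ∀ c x, |A c x| ≤ M) :
    Integrable (fun p : X × ℝ × (ℕ → Fin m) => p.2.1) (srb A lam) := by
  rw [srb, integrable_map_measure measurable_snd.fst.aestronglyMeasurable
    (measurable_Psi hA lam).aemeasurable]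
  exact integrable_S hA hl hl1 hM

/-! ### The boundary functions -/

theorem bddAbove_range_S (hl : 0 < lam) (hl1 : lam < 1) (hM : ∀ c x, |A c x| ≤ M) (x : X) :
    BddAbove (Set.range fun ca : (ℕ → Fin m) × (ℕ → Fin 2) => S A lam x ca.1 ca.2) :=
  ⟨M * (1 - lam)⁻¹, by rintro _ ⟨ca, rfl⟩; exact le_of_abs_le (abs_S_le hl hl1 hM _ _ _)⟩

theorem abs_vPlus_le [NeZero m] (hl : 0 < lam) (hl1 : lam < 1) (hM : ∀ c x, |A c x| ≤ M) (x : X) :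
    |vPlus A lam x| ≤ M * (1 - lam)⁻¹ := by
  refine abs_le.2 ⟨?_, ciSup_le fun ca => le_of_abs_le (abs_S_le hl hl1 hM _ _ _)⟩
  exact (neg_le_of_abs_le (abs_S_le hl hl1 hM x (fun _ => 0) (fun _ => 0))).trans
    (le_ciSup (bddAbove_range_S hl hl1 hM x) ((fun _ => 0), (fun _ => 0)))

/-- In the coordinate `[0, 1)` every `S_x(c, a)` is continuous in `x`. -/
theorem continuous_S_coe (hA : ∀ c, Continuous (A c)) (hl : 0 < lam) (hl1 : lam < 1)
    (hM : ∀ c x, |A c x| ≤ M) (c : ℕ → Fin m) (a : ℕ → Fin 2) :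
    Continuous fun t : Set.Ico (0 : ℝ) 1 => S A lam ((t : ℝ) : X) c a := by
  have e : (fun t : Set.Ico (0 : ℝ) 1 => S A lam ((t : ℝ) : X) c a) = fun t : Set.Ico (0 : ℝ) 1 =>
      ∑' i : ℕ, lam ^ i * A (c i) ((branchLift a (i + 1) t : ℝ) : X) := by
    funext t
    simp only [S, branch_coe a _ t.2]
  rw [e]
  refine continuous_tsum (fun i => continuous_const.mul ((hA _).comp
    ((AddCircle.continuous_mk' 1).comp ((continuous_branchLift a (i + 1)).comp
      continuous_subtype_val)))) ((summable_geometric_of_lt_one hl.le hl1).mul_left M)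
    fun i t => abs_term_le hl hM i _ _

/-- The upper boundary function is a supremum of uncountably many functions; it is measurable since
it is lower semicontinuous in the coordinate `[0, 1)`. -/
theorem measurable_vPlus (hA : ∀ c, Continuous (A c)) (hl : 0 < lam) (hl1 : lam < 1)
    (hM : ∀ c x, |A c x| ≤ M) : Measurable (vPlus A lam) := by
  have h : LowerSemicontinuous fun t : Set.Ico (0 : ℝ) 1 => vPlus A lam ((t : ℝ) : X) :=
    lowerSemicontinuous_ciSup (fun t => bddAbove_range_S hl hl1 hM _) fun ca =>
      (continuous_S_coe hA hl hl1 hM ca.1 ca.2).lowerSemicontinuous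
  have hr : Measurable fun x : X => (⟨rep x, rep_mem x⟩ : Set.Ico (0 : ℝ) 1) :=
    ((AddCircle.measurableEquivIco (1 : ℝ) 0).measurable.subtype_val).subtype_mk
  have h2 := h.measurable.comp hr
  simpa only [Function.comp_def, coe_rep] using h2

theorem integrable_vPlus [NeZero m] (hA : ∀ c, Continuous (A c)) (hl : 0 < lam) (hl1 : lam < 1)
    (hM : ∀ c x, |A c x| ≤ M) : Integrable (vPlus A lam) volume :=
  Integrable.of_bound (measurable_vPlus hA hl hl1 hM).aestronglyMeasurable _
    (ae_of_all _ fun x => abs_vPlus_le hl hl1 hM x)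

theorem S_neg (x : X) (c : ℕ → Fin m) (a : ℕ → Fin 2) :
    S (fun c x => -A c x) lam x c a = -S A lam x c a := by
  simp only [S, mul_neg, tsum_neg]

theorem vMinus_eq (A : Fin m → X → ℝ) (lam : ℝ) (x : X) :
    vMinus A lam x = -vPlus (fun c x => -A c x) lam x := by
  simp only [vMinus, vPlus, S_neg]
  rw [iInf, Real.sInf_def, iSup, ← Set.image_neg_eq_neg, ← Set.range_comp]
  rfl

theorem integral_snd_srb_le [NeZero m] (hA : ∀ c, Continuous (A c)) (hl : 0 < lam)
    (hl1 : lam < 1) (hM : ∀ c x, |A c x| ≤ M) :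
    ∫ p, p.2.1 ∂(srb A lam) ≤ ∫ x, vPlus A lam x := by
  have hfst : MeasurePreserving (Prod.fst : X × (ℕ → Fin 2) × (ℕ → Fin m) × (ℕ → Fin m) → X)
      (base m) volume := measurePreserving_fst
  have hv := integrable_vPlus hA hl hl1 hM
  have e : ∫ x, vPlus A lam x = ∫ p, vPlus A lam p.1 ∂(base m) := by
    conv_lhs => rw [← hfst.map_eq]
    exact integral_map hfst.aemeasurable
      (measurable_vPlus hA hl hl1 hM).aestronglyMeasurable
  rw [e, integral_snd_srb fun c => (hA c).measurable]
  exact integral_mono (integrable_S (fun c => (hA c).measurable) hl hl1 hM)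
    (hfst.integrable_comp_of_integrable hv)
    fun p => le_ciSup (bddAbove_range_S hl hl1 hM p.1) (p.2.2.1, p.2.1)

end Series

/-! ### The uniform holonomic probability -/

/-- Lebesgue measure with independent uniform symbols is holonomic. -/
theorem uniform_mem_holonomic [NeZero m] :
    (volume : Measure X).prod ((unif m).prod (unif 2)) ∈ holonomic m := by
  refine ⟨inferInstance, fun g => ?_⟩
  have hτ : MeasurePreserving (fun p : X × Fin m × Fin 2 => tau p.2.2 p.1)
      ((volume : Measure X).prod ((unif m).prod (unif 2))) volume :=
    (measurePreserving_tau.comp (Measure.measurePreserving_swap (μ := (volume : Measure X)))).comp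
      ((MeasurePreserving.id (volume : Measure X)).prod
        (measurePreserving_snd (μ := unif m) (ν := unif 2)))
  have hfst : MeasurePreserving (Prod.fst : X × Fin m × Fin 2 → X)
      ((volume : Measure X).prod ((unif m).prod (unif 2))) volume := measurePreserving_fst
  have hgi : Integrable g (volume : Measure X) :=
    Integrable.of_bound g.continuous.aestronglyMeasurable ‖g‖
      (ae_of_all _ fun x => g.norm_coe_le_norm x)
  have h1 := integral_map hτ.aemeasurable (f := g) g.continuous.aestronglyMeasurable
  have h2 := integral_map hfst.aemeasurable (f := g) g.continuous.aestronglyMeasurable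
  rw [hτ.map_eq] at h1
  rw [hfst.map_eq] at h2
  have hτi : Integrable (fun p : X × Fin m × Fin 2 => g (tau p.2.2 p.1))
      ((volume : Measure X).prod ((unif m).prod (unif 2))) := hτ.integrable_comp_of_integrable hgi
  have hfi : Integrable (fun p : X × Fin m × Fin 2 => g p.1)
      ((volume : Measure X).prod ((unif m).prod (unif 2))) := hfst.integrable_comp_of_integrable hgi
  rw [integral_sub hτi hfi, ← h1, ← h2, sub_self]

/-- The mean observable is the value of the uniform holonomic probability. -/
theorem meanObs_le_uBar [NeZero m] {A : Fin m → X → ℝ} (hA : ∀ c, Continuous (A c)) :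
    meanObs A ≤ uBar A := by
  obtain ⟨M, hM0, hM⟩ := exists_abs_le A hA
  refine le_csSup ⟨M, ?_⟩ ⟨_, uniform_mem_holonomic, ?_⟩
  · rintro _ ⟨ρ, ⟨hρ, -⟩, rfl⟩
    have h := norm_integral_le_of_norm_le_const (μ := ρ)
      (f := fun p : X × Fin m × Fin 2 => A p.2.1 (tau p.2.2 p.1)) (C := M)
      (ae_of_all _ fun p => hM _ _)
    exact le_of_abs_le (by simpa using h)
  · have h1 := (measurePreserving_prodAssoc (volume : Measure X) (unif 2) (unif m)).symm
    have h2 := (measurePreserving_tau.comp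
      (Measure.measurePreserving_swap (μ := (volume : Measure X)))).prod
        (MeasurePreserving.id (unif m))
    have h3 := (MeasurePreserving.id (volume : Measure X)).prod
      (Measure.measurePreserving_swap (μ := unif m) (ν := unif 2))
    exact integral_obs_comp hA ((h2.comp h1).comp h3)

end SkewIFS

end

theorem mainTheorem2 (m : ℕ) [NeZero m] (A : Fin m → SkewIFS.X → ℝ)
    (hA : ∀ c, ∃ K : ℝ≥0, LipschitzWith K (A c)) :
    (∀ lam : ℝ, 0 < lam → lam < 1 →
      -- the mean of `y` lies between the means of the two boundary functions
      (Integrable (SkewIFS.vMinus A lam) volume ∧ Integrable (SkewIFS.vPlus A lam) volume ∧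
        (∫ x, SkewIFS.vMinus A lam x) ≤ (∫ p, p.2.1 ∂(SkewIFS.srb A lam)) ∧
        (∫ p, p.2.1 ∂(SkewIFS.srb A lam)) ≤ (∫ x, SkewIFS.vPlus A lam x)) ∧
      -- `y ∈ L¹(μ)`
      Integrable (fun p : SkewIFS.X × ℝ × (ℕ → Fin m) => p.2.1) (SkewIFS.srb A lam) ∧
      -- convergence of the averages
      (∃ Ω : Set (SkewIFS.X × ℝ × (ℕ → Fin m)), MeasurableSet Ω ∧ SkewIFS.srb A lam Ω = 1 ∧
        ∀ q ∈ (fun p : SkewIFS.X × ℝ × (ℕ → Fin m) => (p.1, p.2.2)) '' Ω,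
          Tendsto (fun N : ℕ => SkewIFS.orbitAverage A q.1 q.2 N) atTop
            (𝓝 ((1 - lam) * ∫ p, p.2.1 ∂(SkewIFS.srb A lam))))) ∧
    -- the bound by the holonomic supremum for `λ` close to `1`
    (∀ ε : ℝ, 0 < ε → ∃ lam₀ : ℝ, 0 < lam₀ ∧ lam₀ < 1 ∧
      ∀ lam : ℝ, lam₀ < lam → lam < 1 →
        ∃ Ω : Set (SkewIFS.X × ℝ × (ℕ → Fin m)), MeasurableSet Ω ∧ SkewIFS.srb A lam Ω = 1 ∧
          ∀ q ∈ (fun p : SkewIFS.X × ℝ × (ℕ → Fin m) => (p.1, p.2.2)) '' Ω,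
            ∃ N₀ : ℕ, ∀ N : ℕ, N₀ ≤ N →
              SkewIFS.orbitAverage A q.1 q.2 N ≤ SkewIFS.uBar A + ε) := by
  have hA' : ∀ c, Continuous (A c) := fun c => (hA c).choose_spec.continuous
  have hAm : ∀ c, Measurable (A c) := fun c => (hA' c).measurable
  obtain ⟨M, -, hM⟩ := SkewIFS.exists_abs_le A hA'
  refine ⟨fun lam hl hl1 => ⟨?_, SkewIFS.integrable_snd_srb hAm hl hl1 hM, ?_⟩, ?_⟩
  · -- the lower boundary is the negative of the upper boundary for `-A`
    have hN : ∀ c, Continuous fun x => -A c x := fun c => (hA' c).neg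
    have hNM : ∀ c x, |-A c x| ≤ M := fun c x => by rw [abs_neg]; exact hM c x
    have hv : SkewIFS.vMinus A lam = fun x => -SkewIFS.vPlus (fun c x => -A c x) lam x :=
      funext (SkewIFS.vMinus_eq A lam)
    refine ⟨?_, SkewIFS.integrable_vPlus hA' hl hl1 hM, ?_,
      SkewIFS.integral_snd_srb_le hA' hl hl1 hM⟩
    · rw [hv]
      exact (SkewIFS.integrable_vPlus hN hl hl1 hNM).neg
    · have h := SkewIFS.integral_snd_srb_le hN hl hl1 hNM
      rw [SkewIFS.integral_snd_srb fun c => (hN c).measurable] at h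
      simp only [SkewIFS.S_neg, integral_neg] at h
      rw [hv, integral_neg, SkewIFS.integral_snd_srb hAm]
      exact neg_le.1 h
  · have hl0 : (1 - lam) ≠ 0 := (sub_pos.2 hl1).ne'
    rw [SkewIFS.integral_snd_srb hAm, SkewIFS.integral_S hA' hl hl1, mul_inv_cancel_left₀ hl0]
    exact SkewIFS.exists_full_measure_of_ae hAm lam (SkewIFS.ae_tendsto_orbitAverage hA)
  · -- the limit of the averages does not depend on `λ`, so any threshold will do
    refine fun ε hε => ⟨1 / 2, by norm_num, by norm_num, fun lam _ _ => ?_⟩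
    have hlt : SkewIFS.meanObs A < SkewIFS.uBar A + ε :=
      (SkewIFS.meanObs_le_uBar hA').trans_lt (lt_add_of_pos_right _ hε)
    refine SkewIFS.exists_full_measure_of_ae hAm lam ?_
    filter_upwards [SkewIFS.ae_tendsto_orbitAverage hA] with q hq
    exact eventually_atTop.1 (hq.eventually_le_const hlt)
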